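/- Consider a Fisher market with players $1,\dots,n$ ($n\ge 1$) and a set $G$ of $k>3$ goods, with budgets $b_1>\dots>b_n>0$ and unit-demand valuations $v_i:2^G\to\mathbb R_{\ge 0}$, i.e. $v_i(\emptyset)=0$ and $v_i(S)=\max_{g\in S}v_i(\{g\})$ for $S\neq\emptyset$; for each player the values $v_i(\{g\})$, $g\in G$, are pairwise distinct. An outcome $(\mathcal A,\vec p)$ consists of pairwise disjoint bundles $A_1,\dots,A_n\subseteq G$ and prices $p_g\ge 0$; it is an equilibrium if for every $i$ the bundle $A_i$ is affordable ($\sum_{g\in A_i}p_g\le b_i$) and $v_i(S)\le v_i(A_i)$ for every $S\subseteq G$ with $\sum_{g\in S}p_g\le b_i$. The efficiency ratio is $\mathit{ER}_v(\mathcal A)=\sum_i v_i(A_i)/\sum_i v_i(A_i^*)$, where $\mathcal A^*$ is the allocation of a welfare-maximizing equilibrium. Let $g_i^*=\arg\max_{g\in\mathcal G_i}v_i(\{g\})$ with $\mathcal G_1=G$ and $\mathcal G_i=G\setminus\{g_1^*,\dots,g_{i-1}^*\}$ (defined for $i\le \min\{n,k\}$). Given a set $\mathcal S$ of sample bundles,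 the direct unit-demand algorithm works as follows. Start with $\mathit{Alloc}=\emptyset$. For $i=1,\dots,n$: let $\mathcal R=\mathcal S$ and repeat: let $c=\max_{T\in\mathcal R}v_i(T)$, $\mathcal L=\{T\in\mathcal R: v_i(T)=c\}$ and $B=\bigcap_{T\in\mathcal L}T\setminus\bigcup_{T\in\mathcal S,\,v_i(T)<c}T$; if $B\cap\mathit{Alloc}\ne\emptyset$, replace $\mathcal R$ by $\mathcal R\setminus\mathcal L$ and continue; otherwise give $B$ to player $i$ at price $b_i/|B|$ per good, add $B$ to $\mathit{Alloc}$, and pass to the next player (if $\mathcal R$ becomes empty, player $i$ receives nothing in this round). In addition, the goods that occur in no sample go to player $1$, and the remaining goods left over at the end go to player $n$, at price $0$. Let $\mathcal D$ be a product distribution on $2^G$ (each good is included independently of the others) with $\Pr_{S\sim\mathcal D}[g\in S]\in[\alpha,\beta]$ for all $g\in G$, where $$1-\sqrt{2e^{-1/k}-1}\le\alpha,\qquad \beta\le\frac12+\frac{\sqrt{2e^{-1/k}-1}}{2}.$$ Assume that for every agent $i$ for which $g_i^*$ is defined, $$\bigl|\{g\in G: v_i(\{g\})>v_i(\{g_i^*\})\}\bigr|<\frac{\max\{\log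 n,\log k\}}{\log\frac{1}{1-\beta}}.$$ Then a welfare-maximizing equilibrium exists, and if the algorithm is run on $m\ge\max\{k^2n^2,k^4\}$ i.i.d. samples from $\mathcal D$, its output $(\mathcal A,\vec p)$ satisfies $$\Pr[\mathit{ER}_v(\mathcal A)=1]\ \ge\ 1-\frac{2n\max\{\log n,\log k\}}{\log\frac{1}{1-\beta}}\,e^{-k/4}.$$ -/

import Mathlib

noncomputable section

namespace FisherMarket

/-! Players are `Fin n` (player `0` has the largest budget), goods are `Fin k`,
bundles are `Finset (Fin k)`. -/

/-- A unit-demand valuation: non-negative, `0` on the empty bundle, and on any other bundle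
the value of its most valuable good. -/
def IsUnitDemand {k : ℕ} (v : Finset (Fin k) → ℝ) : Prop :=
  (∀ S, 0 ≤ v S) ∧ v ∅ = 0 ∧ ∀ (S : Finset (Fin k)) (hS : S.Nonempty), v S = S.sup' hS fun g => v {g}

/-- A market outcome: one bundle per player and one price per good. -/
structure Outcome (n k : ℕ) where
  alloc : Fin n → Finset (Fin k)
  price : Fin k → ℝ

/-- The bundle `S` is affordable with budget `c` at prices `p`. -/
def Affordable {k : ℕ} (p : Fin k → ℝ) (c : ℝ) (S : Finset (Fin k)) : Prop :=
  ∑ g ∈ S, p g ≤ c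

/-- Walrasian equilibrium of the Fisher market: the bundles are pairwise disjoint, and every
player gets an affordable bundle which is best among all the bundles affordable to them. -/
structure IsEquilibrium {n k : ℕ} (v : Fin n → Finset (Fin k) → ℝ) (b : Fin n → ℝ)
    (O : Outcome n k) : Prop where
  disjoint : ∀ i j, i ≠ j → Disjoint (O.alloc i) (O.alloc j)
  price_nonneg : ∀ g, 0 ≤ O.price g
  affordable : ∀ i, Affordable O.price (b i) (O.alloc i)
  optimal : ∀ i S, Affordable O.price (b i) S → v i S ≤ v i (O.alloc i)

/-- Total welfare of an allocation. -/
def welfare {n k : ℕ} (v : Fin n → Finset (Fin k) → ℝ) (A : Fin n → Finset (Fin k)) : ℝ :=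
  ∑ i, v i (A i)

/-- A welfare-maximizing equilibrium. -/
def IsOptimalEquilibrium {n k : ℕ} (v : Fin n → Finset (Fin k) → ℝ) (b : Fin n → ℝ)
    (O : Outcome n k) : Prop :=
  IsEquilibrium v b O ∧
    ∀ O' : Outcome n k, IsEquilibrium v b O' → welfare v O'.alloc ≤ welfare v O.alloc

/-- Efficiency ratio of the allocation `A`, relative to the allocation `Astar` of a
welfare-maximizing equilibrium. -/
def efficiencyRatio {n k : ℕ} (v : Fin n → Finset (Fin k) → ℝ)
    (A Astar : Fin n → Finset (Fin k)) : ℝ :=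
  welfare v A / welfare v Astar

section Greedy

open scoped Classical in
/-- The goods left when the players preceding player `i` have, in order, each taken
their most valued good among those left. -/
def available {n k : ℕ} (v : Fin n → Finset (Fin k) → ℝ) : ℕ → Finset (Fin k)
  | 0 => Finset.univ
  | i + 1 =>
    if h : i < n then
      {g ∈ available v i | ∃ g' ∈ available v i, v ⟨i, h⟩ {g} < v ⟨i, h⟩ {g'}}
    else available v i

/-- `g` is the good `g_i^*`, i.e. player `i`'s most valued good among those left. -/
def IsGreedyGood {n k : ℕ} (v : Fin n → Finset (Fin k) → ℝ) (i : Fin n) (g : Fin k) : Prop :=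
  g ∈ available v i ∧ ∀ g' ∈ available v i, v i {g'} ≤ v i {g}

end Greedy

section Algorithm

/-! The direct learning algorithm. `𝒮` is the set of samples, `v` the valuation profile (only
its values on samples are used), `b` the budgets. -/

open scoped Classical in
/-- The samples of maximal value among the remaining samples `R`. -/
def topSamples {k : ℕ} (vi : Finset (Fin k) → ℝ) (R : Finset (Finset (Fin k))) :
    Finset (Finset (Fin k)) :=
  {T ∈ R | ∀ U ∈ R, vi U ≤ vi T}

open scoped Classical in
/-- The candidate bundle: the goods that lie in all top samples of `R`, and in no sample
of `𝒮` of smaller value. -/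
def candidate {k : ℕ} (vi : Finset (Fin k) → ℝ) (𝒮 R : Finset (Finset (Fin k))) :
    Finset (Fin k) :=
  {g | (∀ T ∈ topSamples vi R, g ∈ T) ∧
    ∀ C ∈ topSamples vi R, ∀ T ∈ 𝒮, vi T < vi C → g ∉ T}

theorem topSamples_nonempty {k : ℕ} (vi : Finset (Fin k) → ℝ) {R : Finset (Finset (Fin k))}
    (hR : R.Nonempty) : (topSamples vi R).Nonempty := by
  obtain ⟨T, hT, h⟩ := R.exists_max_image vi hR
  exact ⟨T, by simp only [topSamples, Finset.mem_filter]; exact ⟨hT, h⟩⟩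

theorem card_sdiff_topSamples_lt {k : ℕ} (vi : Finset (Fin k) → ℝ)
    {R : Finset (Finset (Fin k))} (hR : R.Nonempty) :
    (R \ topSamples vi R).card < R.card := by
  obtain ⟨T, hT⟩ := topSamples_nonempty vi hR
  have hTR : T ∈ R := (Finset.mem_filter.mp hT).1
  refine Finset.card_lt_card ⟨Finset.sdiff_subset, fun h => ?_⟩
  exact (Finset.mem_sdiff.mp (h hTR)).2 hT

/-- The while loop for one player: as long as the candidate bundle meets the allocated
goods, discard the top samples; otherwise return the candidate bundle. If the samples run
out, the player gets nothing. -/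
def whileLoop {k : ℕ} (vi : Finset (Fin k) → ℝ) (𝒮 : Finset (Finset (Fin k)))
    (Alloc : Finset (Fin k)) (R : Finset (Finset (Fin k))) : Finset (Fin k) :=
  if hR : R.Nonempty then
    if (candidate vi 𝒮 R ∩ Alloc).Nonempty then
      whileLoop vi 𝒮 Alloc (R \ topSamples vi R)
    else candidate vi 𝒮 R
  else ∅
termination_by R.card
decreasing_by exact card_sdiff_topSamples_lt vi hR

/-- The set `Alloc` at the start of round `i` of the for loop. -/
def allocatedBefore {n k : ℕ} (v : Fin n → Finset (Fin k) → ℝ)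
    (𝒮 : Finset (Finset (Fin k))) : ℕ → Finset (Fin k)
  | 0 => ∅
  | i + 1 =>
    if h : i < n then
      allocatedBefore v 𝒮 i ∪ whileLoop (v ⟨i, h⟩) 𝒮 (allocatedBefore v 𝒮 i) 𝒮
    else allocatedBefore v 𝒮 i

/-- The bundle given to player `i` in the for loop. -/
def loopBundle {n k : ℕ} (v : Fin n → Finset (Fin k) → ℝ) (𝒮 : Finset (Finset (Fin k)))
    (i : Fin n) : Finset (Fin k) :=
  whileLoop (v i) 𝒮 (allocatedBefore v 𝒮 i) 𝒮

/-- The goods that occur in some sample. -/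
def observed {k : ℕ} (𝒮 : Finset (Finset (Fin k))) : Finset (Fin k) := 𝒮.sup id

/-- The output of the algorithm: player `i` gets the bundle of round `i`, each good of it
priced at `b_i / |B_i|` (the loop bundles are disjoint); the unobserved goods go to the first
player and the leftover goods to the last player, at price `0`. -/
def directAlgorithm {n k : ℕ} (v : Fin n → Finset (Fin k) → ℝ) (b : Fin n → ℝ)
    (𝒮 : Finset (Finset (Fin k))) : Outcome n k where
  alloc i := loopBundle v 𝒮 i
    ∪ (if (i : ℕ) = 0 then (observed 𝒮)ᶜ else ∅)
    ∪ (if (i : ℕ) + 1 = n then observed 𝒮 \ allocatedBefore v 𝒮 n else ∅)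
  price g := ∑ i, if g ∈ loopBundle v 𝒮 i then b i / ((loopBundle v 𝒮 i).card : ℝ) else 0

end Algorithm

/-- `D` is a product distribution on bundles: for some `p_g ∈ [0,1]`, each good `g` is
included with probability `p_g`, independently of the others. -/
def IsProductDistribution {k : ℕ} (D : PMF (Finset (Fin k))) : Prop :=
  ∃ p : Fin k → ℝ, (∀ g, 0 ≤ p g ∧ p g ≤ 1) ∧
    ∀ S, D S = ENNReal.ofReal ((∏ g ∈ S, p g) * ∏ g ∈ Sᶜ, (1 - p g))

/-- The probability `Pr_{S ∼ D}[g ∈ S]`. -/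
def inclusionProb {k : ℕ} (D : PMF (Finset (Fin k))) (g : Fin k) : ℝ :=
  D.toMeasure.real {S | g ∈ S}

/-- The law of `m` i.i.d. samples from `D`. -/
def sampleMeasure {k : ℕ} (D : PMF (Finset (Fin k))) (m : ℕ) :
    MeasureTheory.Measure (Fin m → Finset (Fin k)) :=
  MeasureTheory.Measure.pi fun _ => D.toMeasure

end FisherMarket

end

/-! Let the players choose in order of budget, each taking the best remaining good of positive
value. With every taken good priced at its owner's budget this serial choice is an equilibrium
(`isEquilibrium_serialOutcome`), and no equilibrium gives any player more
(`IsEquilibrium.le_serialBundle`). So it maximizes welfare, and the ratio is 1 as soon as the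
algorithm reproduces these choices.

Rich enough samples guarantee this (`whileLoop_eq_demand`). If a player should take `g`, the loop
returns `{g}` provided that, for each `h` no better than `g`, some sample has no good better than
`g` and contains exactly one of `g`, `h` (or `g`, if `h = g`). If a player should take nothing,
either no good remains, which is harmless, or a worthless one does. In the latter case the rank
bound `ρ` exceeds `k - 1`, and observing the empty bundle suffices.

A sample avoids fewer than `ρ` given goods with probability at least `(1 - β) ^ ρ = 1 / max n k`,
and independently it separates `g` from `h` with probability at least `1 / (k + 1)`. Hence all `m`
samples miss a required event with probability at most `exp (-(k - 1) k / 2)`. A union bound over `n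
k²` triples and the empty bundle gives failure probability at most `n exp (-k / 4)`, and `ρ ≥ 1 / 2`
turns this into the claim. -/

noncomputable section

namespace FisherMarket

/-! ### Unit-demand valuations -/

section UnitDemand

variable {k : ℕ} {u : Finset (Fin k) → ℝ}

theorem IsUnitDemand.singleton_le (hu : IsUnitDemand u) {S : Finset (Fin k)} {g : Fin k}
    (hg : g ∈ S) : u {g} ≤ u S := by
  rw [hu.2.2 S ⟨g, hg⟩]
  exact Finset.le_sup' (fun g => u {g}) hg

theorem IsUnitDemand.exists_eq (hu : IsUnitDemand u) {S : Finset (Fin k)} (hS : S.Nonempty) :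
    ∃ g ∈ S, u S = u {g} := by
  rw [hu.2.2 S hS]
  exact Finset.exists_mem_eq_sup' hS _

theorem IsUnitDemand.exists_eq_of_pos (hu : IsUnitDemand u) {S : Finset (Fin k)} (hS : 0 < u S) :
    ∃ g ∈ S, u S = u {g} := by
  refine hu.exists_eq (Finset.nonempty_iff_ne_empty.mpr fun h => ?_)
  rw [h, hu.2.1] at hS
  exact lt_irrefl _ hS

theorem IsUnitDemand.le_of_forall (hu : IsUnitDemand u) {S : Finset (Fin k)} {c : ℝ}
    (hc : 0 ≤ c) (h : ∀ g ∈ S, u {g} ≤ c) : u S ≤ c := by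
  rcases S.eq_empty_or_nonempty with rfl | hS
  · rw [hu.2.1]; exact hc
  · obtain ⟨g, hg, he⟩ := hu.exists_eq hS
    rw [he]; exact h g hg

theorem IsUnitDemand.mono (hu : IsUnitDemand u) {S T : Finset (Fin k)} (h : S ⊆ T) : u S ≤ u T :=
  hu.le_of_forall (hu.1 T) fun _ hg => hu.singleton_le (h hg)

end UnitDemand

/-! ### The best good outside a given set -/

section Demand

variable {k : ℕ} {u : Finset (Fin k) → ℝ} {A : Finset (Fin k)}

open scoped Classical in
/-- The most valued good outside `A`, as a bundle, provided its value is positive. -/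
def demand (u : Finset (Fin k) → ℝ) (A : Finset (Fin k)) : Finset (Fin k) :=
  {g | g ∉ A ∧ 0 < u {g} ∧ ∀ g' ∉ A, u {g'} ≤ u {g}}

theorem mem_demand {g : Fin k} :
    g ∈ demand u A ↔ g ∉ A ∧ 0 < u {g} ∧ ∀ g' ∉ A, u {g'} ≤ u {g} := by
  simp [demand]

theorem demand_eq_singleton (hinj : Function.Injective fun g : Fin k => u {g}) {g : Fin k}
    (hg : g ∈ demand u A) : demand u A = {g} := by
  ext x
  rw [Finset.mem_singleton]
  refine ⟨fun hx => hinj ?_, fun h => h ▸ hg⟩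
  rw [mem_demand] at hx hg
  exact le_antisymm (hg.2.2 x hx.1) (hx.2.2 g hg.1)

theorem eq_zero_of_demand_eq_empty (hu : IsUnitDemand u) (h : demand u A = ∅) {g : Fin k}
    (hg : g ∉ A) : u {g} = 0 := by
  by_contra hne
  have hpos : 0 < u {g} := lt_of_le_of_ne (hu.1 _) (Ne.symm hne)
  obtain ⟨x, hx, hmax⟩ := Aᶜ.exists_max_image (fun g => u {g}) ⟨g, by simpa using hg⟩
  have : x ∈ demand u A := mem_demand.mpr ⟨by simpa using hx,
    hpos.trans_le (hmax g (by simpa using hg)), fun g' hg' => hmax g' (by simpa using hg')⟩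
  simp [h] at this

theorem le_demand (hu : IsUnitDemand u) {g : Fin k} (hg : g ∉ A) : u {g} ≤ u (demand u A) := by
  rcases (demand u A).eq_empty_or_nonempty with h | ⟨x, hx⟩
  · rw [eq_zero_of_demand_eq_empty hu h hg]; exact hu.1 _
  · exact ((mem_demand.mp hx).2.2 g hg).trans (hu.singleton_le hx)

/-- Adding goods outside `A` does not increase the value of the demanded bundle. -/
theorem demand_union (hu : IsUnitDemand u) {X : Finset (Fin k)} (hX : Disjoint X A) :
    u (demand u A ∪ X) = u (demand u A) := by
  refine le_antisymm (hu.le_of_forall (hu.1 _) fun g hg => ?_)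
    (hu.mono Finset.subset_union_left)
  rcases Finset.mem_union.mp hg with hg | hg
  · exact hu.singleton_le hg
  · exact le_demand hu (Finset.disjoint_left.mp hX hg)

end Demand

/-! ### Serial choice and welfare-maximizing equilibria -/

section Serial

variable {n k : ℕ} {v : Fin n → Finset (Fin k) → ℝ} {b : Fin n → ℝ}

/-- The goods taken by the players before player `i` when the players, in order, each take their
most valued remaining good of positive value. -/
def takenBefore (v : Fin n → Finset (Fin k) → ℝ) : ℕ → Finset (Fin k)
  | 0 => ∅
  | i + 1 =>
    if h : i < n then takenBefore v i ∪ demand (v ⟨i, h⟩) (takenBefore v i) else takenBefore v i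

/-- The bundle of player `i` under serial choice. -/
def serialBundle (v : Fin n → Finset (Fin k) → ℝ) (i : Fin n) : Finset (Fin k) :=
  demand (v i) (takenBefore v i)

theorem takenBefore_succ (i : Fin n) :
    takenBefore v (i + 1) = takenBefore v i ∪ serialBundle v i := by
  simp [takenBefore, serialBundle]

theorem mem_takenBefore {g : Fin k} {i : ℕ} :
    g ∈ takenBefore v i ↔ ∃ j : Fin n, (j : ℕ) < i ∧ g ∈ serialBundle v j := by
  induction i with
  | zero => simp [takenBefore]
  | succ i ih =>
    by_cases h : i < n
    · have := takenBefore_succ (v := v) ⟨i, h⟩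
      simp only at this
      rw [this, Finset.mem_union, ih]
      constructor
      · rintro (⟨j, hj, hg⟩ | hg)
        · exact ⟨j, by omega, hg⟩
        · exact ⟨⟨i, h⟩, by simp, hg⟩
      · rintro ⟨j, hj, hg⟩
        rcases Nat.lt_succ_iff_lt_or_eq.mp hj with hj | hj
        · exact Or.inl ⟨j, hj, hg⟩
        · right
          have : j = ⟨i, h⟩ := Fin.ext hj
          exact this ▸ hg
    · rw [takenBefore, dif_neg h, ih]
      exact ⟨fun ⟨j, hj, hg⟩ => ⟨j, by omega, hg⟩, fun ⟨j, _, hg⟩ => ⟨j, by omega, hg⟩⟩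

theorem serialBundle_disjoint {i j : Fin n} (hij : i ≠ j) :
    Disjoint (serialBundle v i) (serialBundle v j) := by
  have key : ∀ i j : Fin n, i < j → Disjoint (serialBundle v i) (serialBundle v j) :=
    fun i j h => Finset.disjoint_right.mpr fun g hg hg' =>
      (mem_demand.mp hg).1 (mem_takenBefore.mpr ⟨i, h, hg'⟩)
  rcases lt_or_gt_of_ne hij with h | h
  · exact key i j h
  · exact (key j i h).symm

open scoped Classical in
/-- Serial choice, each chosen good being priced at the budget of its owner. -/
def serialOutcome (v : Fin n → Finset (Fin k) → ℝ) (b : Fin n → ℝ) : Outcome n k where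
  alloc := serialBundle v
  price g := ∑ i, if g ∈ serialBundle v i then b i else 0

theorem serialOutcome_price {i : Fin n} {g : Fin k} (hg : g ∈ serialBundle v i) :
    (serialOutcome v b).price g = b i := by
  simp only [serialOutcome]
  rw [Finset.sum_eq_single i, if_pos hg]
  · intro j _ hj
    exact if_neg fun h => Finset.disjoint_left.mp (serialBundle_disjoint hj) h hg
  · simp

theorem serialOutcome_price_nonneg (hbpos : ∀ i, 0 < b i) (g : Fin k) :
    0 ≤ (serialOutcome v b).price g := by
  simp only [serialOutcome]
  refine Finset.sum_nonneg fun i _ => ?_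
  split_ifs
  exacts [(hbpos i).le, le_rfl]

/-- A good taken earlier costs a strictly larger budget, so an affordable bundle contains only goods
not yet taken, and the demanded good is the best of these. -/
theorem isEquilibrium_serialOutcome (hv : ∀ i, IsUnitDemand (v i))
    (hdistinct : ∀ i, Function.Injective fun g : Fin k => v i {g})
    (hbpos : ∀ i, 0 < b i) (hb : StrictAnti b) : IsEquilibrium v b (serialOutcome v b) where
  disjoint _ _ h := serialBundle_disjoint h
  price_nonneg := serialOutcome_price_nonneg hbpos
  affordable i := by
    change ∑ g ∈ serialBundle v i, _ ≤ _
    rcases (serialBundle v i).eq_empty_or_nonempty with h | ⟨g, hg⟩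
    · rw [h]; simpa using (hbpos i).le
    · rw [show serialBundle v i = {g} from demand_eq_singleton (hdistinct i) hg,
        Finset.sum_singleton, serialOutcome_price hg]
  optimal i S hS := by
    refine (hv i).le_of_forall ((hv i).1 _) fun g hg => le_demand (hv i) fun hmem => ?_
    obtain ⟨j, hj, hgj⟩ := mem_takenBefore.mp hmem
    have h1 : (serialOutcome v b).price g ≤ b i := 
      (Finset.single_le_sum (f := (serialOutcome v b).price)
        (fun x _ => serialOutcome_price_nonneg hbpos x) hg).trans hS
    rw [serialOutcome_price hgj] at h1
    exact absurd (hb (show j < i from hj)) (not_lt.mpr h1)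

/-- No player does better in an equilibrium than under serial choice. -/
theorem IsEquilibrium.le_serialBundle (hv : ∀ i, IsUnitDemand (v i))
    (hdistinct : ∀ i, Function.Injective fun g : Fin k => v i {g}) (hb : StrictAnti b)
    {O : Outcome n k} (hO : IsEquilibrium v b O) (i : Fin n) :
    v i (O.alloc i) ≤ v i (serialBundle v i) := by
  induction i using WellFoundedLT.induction with
  | ind i ih =>
    refine (hv i).le_of_forall ((hv i).1 _) fun g hg => le_demand (hv i) fun hmem => ?_
    obtain ⟨j, hj, hgj⟩ := mem_takenBefore.mp hmem
    have hprice : O.price g ≤ b i :=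
      (Finset.single_le_sum (fun x _ => hO.price_nonneg x) hg).trans (hO.affordable i)
    -- The richer player `j` can also afford `g`. Optimality and the induction hypothesis then pin
    -- the value of `j`'s bundle to that of `g`; distinct values force `j` to hold `g` too.
    have hafford : Affordable O.price (b j) {g} := by
      rw [Affordable, Finset.sum_singleton]
      exact hprice.trans (hb (show j < i from hj)).le
    have hle := hO.optimal j {g} hafford
    have hge := ih j hj
    rw [show serialBundle v j = {g} from demand_eq_singleton (hdistinct j) hgj] at hge
    have heq := le_antisymm hge hle
    obtain ⟨x, hx, he⟩ := (hv j).exists_eq_of_pos (heq ▸ (mem_demand.mp hgj).2.1)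
    have hxg : x = g := hdistinct j (he.symm.trans heq)
    have hji : j ≠ i := (show j < i from hj).ne
    exact Finset.disjoint_left.mp (hO.disjoint j i hji) (hxg ▸ hx) hg

/-- Serial choice is a welfare-maximizing equilibrium. -/
theorem isOptimalEquilibrium_serialOutcome (hv : ∀ i, IsUnitDemand (v i))
    (hdistinct : ∀ i, Function.Injective fun g : Fin k => v i {g})
    (hbpos : ∀ i, 0 < b i) (hb : StrictAnti b) :
    IsOptimalEquilibrium v b (serialOutcome v b) :=
  ⟨isEquilibrium_serialOutcome hv hdistinct hbpos hb, fun _ hO =>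
    Finset.sum_le_sum fun i _ => hO.le_serialBundle hv hdistinct hb i⟩

theorem IsOptimalEquilibrium.welfare_eq (hv : ∀ i, IsUnitDemand (v i))
    (hdistinct : ∀ i, Function.Injective fun g : Fin k => v i {g})
    (hbpos : ∀ i, 0 < b i) (hb : StrictAnti b) {O : Outcome n k}
    (hO : IsOptimalEquilibrium v b O) : welfare v O.alloc = welfare v (serialBundle v) :=
  have h := isOptimalEquilibrium_serialOutcome hv hdistinct hbpos hb
  le_antisymm (h.2 O hO.1) (hO.2 _ h.1)

/-- At most one good is worthless to the first player. Positivity rules out the degenerate ratio `0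
/ 0`. -/
theorem welfare_serialBundle_pos (hn : 1 ≤ n) (hk : 1 < k) (hv : ∀ i, IsUnitDemand (v i))
    (hdistinct : ∀ i, Function.Injective fun g : Fin k => v i {g}) :
    0 < welfare v (serialBundle v) := by
  have hle : v ⟨0, hn⟩ (serialBundle v ⟨0, hn⟩) ≤ welfare v (serialBundle v) :=
    Finset.single_le_sum (f := fun i => v i (serialBundle v i)) (fun i _ => (hv i).1 _)
      (Finset.mem_univ _)
  refine lt_of_lt_of_le ?_ hle
  have hbd : ∀ g, v ⟨0, hn⟩ {g} ≤ v ⟨0, hn⟩ (serialBundle v ⟨0, hn⟩) := fun g =>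
    le_demand (hv _) (by simp [takenBefore])
  by_contra h
  have hz : ∀ g, v ⟨0, hn⟩ {g} = 0 := fun g =>
    le_antisymm ((hbd g).trans (not_lt.mp h)) ((hv _).1 _)
  have := hdistinct ⟨0, hn⟩ ((hz ⟨0, by omega⟩).trans (hz ⟨1, hk⟩).symm)
  simp at this

/-- As long as no player meets a worthless best good, serial choice agrees with the greedy
choice. A player who does ranks that good below all the others. -/
theorem available_eq_or_lt (hv : ∀ i, IsUnitDemand (v i))
    (hdistinct : ∀ i, Function.Injective fun g : Fin k => v i {g}) {ρ : ℝ}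
    (hrank : ∀ (i : Fin n) (g : Fin k), IsGreedyGood v i g →
      (Set.ncard {g' : Fin k | v i {g} < v i {g'}} : ℝ) < ρ) (i : ℕ) :
    available v i = (takenBefore v i)ᶜ ∨ (k : ℝ) - 1 < ρ := by
  induction i with
  | zero => left; simp [available, takenBefore]
  | succ i ih =>
    rcases ih with ih | ih
    swap
    · exact Or.inr ih
    by_cases h : i < n
    swap
    · left; rw [available, takenBefore, dif_neg h, dif_neg h, ih]
    rw [available, takenBefore, dif_pos h, dif_pos h, ih]
    rcases (demand (v ⟨i, h⟩) (takenBefore v i)).eq_empty_or_nonempty with hd | ⟨g, hg⟩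
    · by_cases hA : ∃ g, g ∉ takenBefore v i
      · right
        obtain ⟨g, hg⟩ := hA
        have hz : ∀ x ∉ takenBefore v i, v ⟨i, h⟩ {x} = 0 := fun x hx =>
          eq_zero_of_demand_eq_empty (hv _) hd hx
        have hgr : IsGreedyGood v ⟨i, h⟩ g := by
          refine ⟨by simpa [ih] using hg, fun x hx => ?_⟩
          rw [hz g hg, hz x (by simpa [ih] using hx)]
        -- Distinct values allow only one worthless good, so the other `k - 1` goods are all
        -- strictly better.
        have hset : {g' : Fin k | v ⟨i, h⟩ {g} < v ⟨i, h⟩ {g'}} = ((Finset.univ.erase g :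
            Finset (Fin k)) : Set (Fin k)) := by
          ext x
          simp only [Set.mem_ofPred_eq, Finset.coe_erase, Finset.coe_univ, Set.mem_sdiff,
            Set.mem_univ, Set.mem_singleton_iff, true_and]
          refine ⟨fun hlt hxg => by simp [hxg] at hlt, fun hne => ?_⟩
          rw [hz g hg]
          refine lt_of_le_of_ne ((hv _).1 _) fun h0 => hne (hdistinct ⟨i, h⟩ ?_)
          exact h0.symm.trans (hz g hg).symm
        have hr := hrank ⟨i, h⟩ g hgr
        have hkpos : 1 ≤ k := by have := g.2; omega
        rw [hset, Set.ncard_coe_finset, Finset.card_erase_of_mem (Finset.mem_univ g),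
          Finset.card_univ, Fintype.card_fin, Nat.cast_sub hkpos, Nat.cast_one] at hr
        exact hr
      · left
        push Not at hA
        ext x
        simp [hA x]
    · left
      rw [demand_eq_singleton (hdistinct _) hg]
      obtain ⟨hgA, -, hmax⟩ := mem_demand.mp hg
      ext x
      simp only [Finset.mem_filter, Finset.mem_compl, Finset.mem_union, Finset.mem_singleton,
        not_or]
      refine and_congr_right fun hx => ⟨?_, fun hne => ⟨g, hgA, ?_⟩⟩
      · rintro ⟨y, hy, hlt⟩ rfl
        exact absurd (hmax y hy) (not_le.mpr hlt)
      · exact lt_of_le_of_ne (hmax x hx) fun he => hne (hdistinct ⟨i, h⟩ he)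

theorem ncard_better_le (i : Fin n) (g : Fin k) :
    (Set.ncard {g' : Fin k | v i {g} < v i {g'}} : ℝ) ≤ (k : ℝ) - 1 := by
  have h : Set.ncard {g' : Fin k | v i {g} < v i {g'}} < k := by
    have := Set.ncard_lt_ncard (s := {g' : Fin k | v i {g} < v i {g'}}) (t := Set.univ)
      (Set.ssubset_univ_iff.mpr fun h => by
        have : g ∈ {g' : Fin k | v i {g} < v i {g'}} := h ▸ Set.mem_univ g
        simp at this) Set.finite_univ
    simpa [Set.ncard_univ] using this
  have : ((Set.ncard {g' : Fin k | v i {g} < v i {g'}} + 1 : ℕ) : ℝ) ≤ k := by exact_mod_cast h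
  push_cast at this
  linarith

/-- Either the serial good is the greedy good, or `ρ` is so large that the bound holds for every
good. -/
theorem ncard_better_serialBundle_lt (hv : ∀ i, IsUnitDemand (v i))
    (hdistinct : ∀ i, Function.Injective fun g : Fin k => v i {g}) {ρ : ℝ}
    (hrank : ∀ (i : Fin n) (g : Fin k), IsGreedyGood v i g →
      (Set.ncard {g' : Fin k | v i {g} < v i {g'}} : ℝ) < ρ) {i : Fin n} {g : Fin k}
    (hg : g ∈ serialBundle v i) : (Set.ncard {g' : Fin k | v i {g} < v i {g'}} : ℝ) < ρ := by
  rcases available_eq_or_lt hv hdistinct hrank i with h | h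
  · obtain ⟨hgA, -, hmax⟩ := mem_demand.mp hg
    exact hrank i g ⟨by simpa [h] using hgA, fun x hx => hmax x (by simpa [h] using hx)⟩
  · exact (ncard_better_le i g).trans_lt h

theorem eq_univ_or_lt_of_serialBundle_eq_empty (hv : ∀ i, IsUnitDemand (v i))
    (hdistinct : ∀ i, Function.Injective fun g : Fin k => v i {g}) {ρ : ℝ}
    (hrank : ∀ (i : Fin n) (g : Fin k), IsGreedyGood v i g →
      (Set.ncard {g' : Fin k | v i {g} < v i {g'}} : ℝ) < ρ) {i : Fin n}
    (h : serialBundle v i = ∅) : takenBefore v i = Finset.univ ∨ (k : ℝ) - 1 < ρ := by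
  rcases available_eq_or_lt hv hdistinct hrank (i + 1) with h1 | h1
  swap
  · exact Or.inr h1
  rcases available_eq_or_lt hv hdistinct hrank i with h2 | h2
  swap
  · exact Or.inr h2
  left
  -- With nothing taken the available set is unchanged, whereas the greedy recursion always drops
  -- the maximizers of a nonempty set.
  rw [takenBefore_succ, h, Finset.union_empty, ← h2] at h1
  rw [← Finset.compl_eq_empty_iff, ← h2]
  by_contra hne
  obtain ⟨x, hx, hmax⟩ := (available v i).exists_max_image (fun g => v i {g})
    (Finset.nonempty_iff_ne_empty.mpr hne)
  rw [← h1, available, dif_pos i.2, Finset.mem_filter] at hx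
  obtain ⟨-, y, hy, hlt⟩ := hx
  exact absurd (hmax y hy) (not_le.mpr hlt)

end Serial

/-! ### Correctness of the while loop for one player -/

section Loop

variable {k : ℕ} {u : Finset (Fin k) → ℝ} {𝒮 R : Finset (Finset (Fin k))} {A : Finset (Fin k)}

theorem mem_topSamples {T : Finset (Fin k)} :
    T ∈ topSamples u R ↔ T ∈ R ∧ ∀ U ∈ R, u U ≤ u T := by
  simp [topSamples]

theorem mem_candidate {g : Fin k} : g ∈ candidate u 𝒮 R ↔
    (∀ T ∈ topSamples u R, g ∈ T) ∧
      ∀ C ∈ topSamples u R, ∀ T ∈ 𝒮, u T < u C → g ∉ T := by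
  simp [candidate]

/-- A most valued good of positive value of a top sample lies in the candidate bundle. -/
theorem mem_candidate_of_top (hu : IsUnitDemand u)
    (hinj : Function.Injective fun g : Fin k => u {g}) {C : Finset (Fin k)}
    (hC : C ∈ topSamples u R) {g : Fin k} (hg : u C = u {g}) (hpos : 0 < u C) :
    g ∈ candidate u 𝒮 R := by
  have heq : ∀ T ∈ topSamples u R, u T = u {g} := fun T hT => by
    rw [← hg]
    exact le_antisymm ((mem_topSamples.mp hC).2 T (mem_topSamples.mp hT).1)
      ((mem_topSamples.mp hT).2 C (mem_topSamples.mp hC).1)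
  refine mem_candidate.mpr ⟨fun T hT => ?_, fun T hT U _ hlt hgU => ?_⟩
  · have hT' := heq T hT
    obtain ⟨x, hx, he⟩ := hu.exists_eq_of_pos (S := T) (by rw [hT', ← hg]; exact hpos)
    have : x = g := hinj (by simpa using he.symm.trans hT')
    exact this ▸ hx
  · rw [heq T hT] at hlt
    exact absurd (hu.singleton_le hgU) (not_le.mpr hlt)

theorem whileLoop_disjoint : Disjoint (whileLoop u 𝒮 A R) A := by
  induction R using whileLoop.induct u 𝒮 A with
  | case1 R hR h ih => rw [whileLoop, dif_pos hR, if_pos h]; exact ih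
  | case2 R hR h =>
    rw [whileLoop, dif_pos hR, if_neg h, Finset.disjoint_iff_inter_eq_empty]
    exact Finset.not_nonempty_iff_eq_empty.mp h
  | case3 R hR => rw [whileLoop, dif_neg hR]; exact Finset.disjoint_empty_left A

/-- The samples that tell `h` apart from `g` at the level of `g`: they contain no good better
than `g`, and exactly one of `g` and `h`; or `g` if `h = g`. -/
def separating (u : Finset (Fin k) → ℝ) (g h : Fin k) : Set (Finset (Fin k)) :=
  {T | (∀ x ∈ T, u {x} ≤ u {g}) ∧ (h = g ∧ g ∈ T ∨ h ≠ g ∧ (g ∈ T ↔ h ∉ T))}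

/-- The sample for `h = g` is a top sample and excludes all goods better than `g`. For any other
`h`, a separating sample containing `g` is a top sample without `h`; one containing `h` has value
below `u {g}`. Either way `h` is not a candidate. -/
theorem candidate_eq_singleton (hu : IsUnitDemand u)
    (hinj : Function.Injective fun g : Fin k => u {g}) {g : Fin k} (hpos : 0 < u {g})
    (htop : ∀ T, T ∈ topSamples u R ↔ T ∈ 𝒮 ∧ u T = u {g})
    (hsep : ∀ h, u {h} ≤ u {g} → ∃ T ∈ 𝒮, T ∈ separating u g h) :
    candidate u 𝒮 R = {g} := by
  have hval : ∀ T, (∀ x ∈ T, u {x} ≤ u {g}) → g ∈ T → u T = u {g} := fun T h1 h2 =>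
    le_antisymm (hu.le_of_forall (hu.1 _) h1) (hu.singleton_le h2)
  obtain ⟨T₀, hT₀, hle₀, h₀⟩ := hsep g le_rfl
  have hgT₀ : g ∈ T₀ := by tauto
  have htop₀ : T₀ ∈ topSamples u R := (htop _).mpr ⟨hT₀, hval _ hle₀ hgT₀⟩
  ext x
  rw [Finset.mem_singleton]
  constructor
  · intro hx
    obtain ⟨hx1, hx2⟩ := mem_candidate.mp hx
    by_contra hne
    have hxle := hle₀ x (hx1 T₀ htop₀)
    obtain ⟨T, hT, hle, hT'⟩ := hsep x hxle
    have hiff : g ∈ T ↔ x ∉ T := by tauto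
    by_cases hg : g ∈ T
    · exact (hiff.mp hg) (hx1 T ((htop T).mpr ⟨hT, hval T hle hg⟩))
    · have hxT : x ∈ T := by tauto
      refine hx2 T₀ htop₀ T hT ?_ hxT
      rw [hval T₀ hle₀ hgT₀]
      obtain ⟨y, hy, he⟩ := hu.exists_eq ⟨x, hxT⟩
      rw [he]
      refine lt_of_le_of_ne (hle y hy) fun h => hg ?_
      have : y = g := hinj h
      exact this ▸ hy
  · rintro rfl
    have h := ((htop _).mp htop₀).2
    exact mem_candidate_of_top hu hinj htop₀ h (h ▸ hpos)

/-- If the top samples are worth more than every good outside `A`, they are discarded. -/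
theorem candidate_inter_nonempty (hu : IsUnitDemand u)
    (hinj : Function.Injective fun g : Fin k => u {g}) {C : Finset (Fin k)}
    (hC : C ∈ topSamples u R) (hpos : 0 < u C) (hA : ∀ g ∉ A, u {g} < u C) :
    (candidate u 𝒮 R ∩ A).Nonempty := by
  obtain ⟨x, hx, he⟩ := hu.exists_eq_of_pos hpos
  refine ⟨x, Finset.mem_inter.mpr ⟨mem_candidate_of_top hu hinj hC he hpos, ?_⟩⟩
  by_contra hxA
  exact absurd (hA x hxA) (by rw [he]; exact lt_irrefl _)

/-- The invariant is that all samples of value `u {g}` are still in `R`. That level is never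
discarded, since its candidate `{g}` misses `A`; the loop cannot stop at a higher level, where the
candidate meets `A`. -/
theorem whileLoop_eq_singleton (hu : IsUnitDemand u)
    (hinj : Function.Injective fun g : Fin k => u {g}) {g : Fin k} (hg : g ∈ demand u A)
    (hsep : ∀ h, u {h} ≤ u {g} → ∃ T ∈ 𝒮, T ∈ separating u g h)
    (hR : R ⊆ 𝒮) (hlev : ∀ T ∈ 𝒮, u T = u {g} → T ∈ R) : whileLoop u 𝒮 A R = {g} := by
  obtain ⟨hgA, hpos, hmax⟩ := mem_demand.mp hg
  obtain ⟨T₀, hT₀, hle₀, h₀⟩ := hsep g le_rfl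
  have hgT₀ : g ∈ T₀ := by tauto
  have hval : u T₀ = u {g} :=
    le_antisymm (hu.le_of_forall (hu.1 _) hle₀) (hu.singleton_le hgT₀)
  induction R using whileLoop.induct u 𝒮 A with
  | case1 R hne h ih =>
    rw [whileLoop, dif_pos hne, if_pos h]
    refine ih (Finset.sdiff_subset.trans hR) fun T hT he =>
      Finset.mem_sdiff.mpr ⟨hlev T hT he, fun htop => ?_⟩
    have : candidate u 𝒮 R = {g} := candidate_eq_singleton hu hinj hpos (fun U => ?_) hsep
    · rw [this] at h
      obtain ⟨x, hx⟩ := h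
      rw [Finset.mem_inter, Finset.mem_singleton] at hx
      exact hgA (hx.1 ▸ hx.2)
    · rw [mem_topSamples]
      refine ⟨fun hU => ⟨hR hU.1, ?_⟩, fun hU => ⟨hlev U hU.1 hU.2, fun W hW => ?_⟩⟩
      · rw [← he]
        exact le_antisymm ((mem_topSamples.mp htop).2 U hU.1) (hU.2 T (hlev T hT he))
      · rw [hU.2, ← he]; exact (mem_topSamples.mp htop).2 W hW
  | case2 R hne h =>
    rw [whileLoop, dif_pos hne, if_neg h]
    obtain ⟨C, hC⟩ := topSamples_nonempty u hne
    have hCge : u {g} ≤ u C := hval ▸ (mem_topSamples.mp hC).2 T₀ (hlev T₀ hT₀ hval)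
    have hCeq : u C = u {g} := by
      refine le_antisymm (not_lt.mp fun hlt => h ?_) hCge
      exact candidate_inter_nonempty hu hinj hC (hpos.trans hlt)
        fun x hx => (hmax x hx).trans_lt hlt
    refine candidate_eq_singleton hu hinj hpos (fun U => ?_) hsep
    rw [mem_topSamples]
    refine ⟨fun hU => ⟨hR hU.1, ?_⟩, fun hU => ⟨hlev U hU.1 hU.2, fun W hW => ?_⟩⟩
    · rw [← hCeq]
      exact le_antisymm ((mem_topSamples.mp hC).2 U hU.1) (hU.2 C (mem_topSamples.mp hC).1)
    · rw [hU.2, ← hCeq]; exact (mem_topSamples.mp hC).2 W hW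
  | case3 R hne => exact absurd ⟨T₀, hlev T₀ hT₀ hval⟩ hne

/-- A level containing the empty sample has an empty candidate, so it is never discarded; levels of
positive value always are. -/
theorem whileLoop_eq_empty (hu : IsUnitDemand u)
    (hinj : Function.Injective fun g : Fin k => u {g}) (hA : demand u A = ∅)
    (hR : ∅ ∈ R) : whileLoop u 𝒮 A R = ∅ := by
  induction R using whileLoop.induct u 𝒮 A with
  | case1 R hne h ih =>
    rw [whileLoop, dif_pos hne, if_pos h]
    refine ih (Finset.mem_sdiff.mpr ⟨hR, fun htop => ?_⟩)
    obtain ⟨x, hx⟩ := h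
    simpa using (mem_candidate.mp (Finset.mem_inter.mp hx).1).1 ∅ htop
  | case2 R hne h =>
    rw [whileLoop, dif_pos hne, if_neg h]
    obtain ⟨C, hC⟩ := topSamples_nonempty u hne
    have hC0 : u C ≤ 0 := not_lt.mp fun hlt => h <|
      candidate_inter_nonempty hu hinj hC hlt fun x hx => by
        rw [eq_zero_of_demand_eq_empty hu hA hx]; exact hlt
    have htop : ∅ ∈ topSamples u R := mem_topSamples.mpr ⟨hR, fun U hU => by
      rw [hu.2.1]; exact ((mem_topSamples.mp hC).2 U hU).trans hC0⟩
    refine Finset.eq_empty_of_forall_notMem fun x hx => ?_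
    simpa using (mem_candidate.mp hx).1 ∅ htop
  | case3 R hne => exact absurd ⟨∅, hR⟩ hne

/-- The while loop returns the demanded bundle. -/
theorem whileLoop_eq_demand (hu : IsUnitDemand u)
    (hinj : Function.Injective fun g : Fin k => u {g})
    (hsep : ∀ g ∈ demand u A, ∀ h, u {h} ≤ u {g} → ∃ T ∈ 𝒮, T ∈ separating u g h)
    (hempty : demand u A = ∅ → A = Finset.univ ∨ ∅ ∈ 𝒮) :
    whileLoop u 𝒮 A 𝒮 = demand u A := by
  rcases (demand u A).eq_empty_or_nonempty with h | ⟨g, hg⟩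
  · rw [h]
    rcases hempty h with rfl | h'
    · exact Finset.disjoint_self_iff_empty _ |>.mp
        (whileLoop_disjoint.mono_right (Finset.subset_univ _))
    · exact whileLoop_eq_empty hu hinj h h'
  · rw [demand_eq_singleton hinj hg]
    exact whileLoop_eq_singleton hu hinj hg (hsep g hg) subset_rfl fun _ h _ => h

end Loop

/-! ### From single rounds to the output -/

section Output

variable {n k : ℕ} {v : Fin n → Finset (Fin k) → ℝ} {𝒮 : Finset (Finset (Fin k))}

/-- The hypothesis starts each round from the serial set rather than the computed one, so the rounds
can be analysed separately. -/
theorem allocatedBefore_eq_takenBefore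
    (hloop : ∀ i : Fin n, whileLoop (v i) 𝒮 (takenBefore v i) 𝒮 = serialBundle v i) (i : ℕ) :
    allocatedBefore v 𝒮 i = takenBefore v i := by
  induction i with
  | zero => rfl
  | succ i ih =>
    rw [allocatedBefore, takenBefore, ih]
    by_cases h : i < n
    · rw [dif_pos h, dif_pos h, hloop ⟨i, h⟩, serialBundle]
    · rw [dif_neg h, dif_neg h]

/-- If every round reproduces serial choice, so does the output, up to goods without effect
on the values. -/
theorem welfare_directAlgorithm_eq (hv : ∀ i, IsUnitDemand (v i)) (b : Fin n → ℝ)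
    (hloop : ∀ i : Fin n, whileLoop (v i) 𝒮 (takenBefore v i) 𝒮 = serialBundle v i) :
    welfare v (directAlgorithm v b 𝒮).alloc = welfare v (serialBundle v) := by
  refine Finset.sum_congr rfl fun i _ => ?_
  have hbundle : loopBundle v 𝒮 i = demand (v i) (takenBefore v i) := by
    rw [loopBundle, allocatedBefore_eq_takenBefore hloop, hloop, serialBundle]
  simp only [directAlgorithm]
  rw [hbundle, Finset.union_assoc, demand_union (hv i), serialBundle]
  rw [Finset.disjoint_union_left]
  constructor
  -- The first player chooses among all goods, so unobserved goods add no value; the leftovers given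
  -- to the last player avoid everything taken.
  · split_ifs with h
    · rw [h]; simp [takenBefore]
    · simp
  · split_ifs with h
    · rw [allocatedBefore_eq_takenBefore hloop]
      refine Finset.disjoint_left.mpr fun g hg hg' => (Finset.mem_sdiff.mp hg).2 ?_
      obtain ⟨j, -, hj⟩ := mem_takenBefore.mp hg'
      exact mem_takenBefore.mpr ⟨j, j.2, hj⟩
    · simp

end Output

/-! ### Probabilities under the product distribution -/

section Product

variable {k : ℕ} {D : PMF (Finset (Fin k))} {p : Fin k → ℝ}

open MeasureTheory

/-- The probability that a random bundle meets `X` exactly in `Y`. -/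
theorem measureReal_inter_eq (hp : ∀ g, 0 ≤ p g ∧ p g ≤ 1)
    (hD : ∀ S, D S = ENNReal.ofReal ((∏ g ∈ S, p g) * ∏ g ∈ Sᶜ, (1 - p g)))
    {X Y : Finset (Fin k)} (hYX : Y ⊆ X) :
    D.toMeasure.real {S | S ∩ X = Y} = (∏ g ∈ Y, p g) * ∏ g ∈ X \ Y, (1 - p g) := by
  have hreal : D.toMeasure.real {S | S ∩ X = Y} =
      ∑ S, if S ∩ X = Y then (∏ g ∈ S, p g) * ∏ g ∈ Sᶜ, (1 - p g) else 0 := by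
    rw [Measure.real, PMF.toMeasure_apply_fintype, ENNReal.toReal_sum]
    · refine Finset.sum_congr rfl fun S _ => ?_
      by_cases h : S ∩ X = Y
      · rw [if_pos h, Set.indicator_of_mem (by exact h), hD, ENNReal.toReal_ofReal]
        exact mul_nonneg (Finset.prod_nonneg fun g _ => (hp g).1)
          (Finset.prod_nonneg fun g _ => sub_nonneg.mpr (hp g).2)
      · rw [if_neg h, Set.indicator_of_notMem (by exact h), ENNReal.toReal_zero]
    · intro S _
      by_cases h : S ∩ X = Y
      · rw [Set.indicator_of_mem (by exact h)]; exact D.apply_ne_top S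
      · rw [Set.indicator_of_notMem (by exact h)]; exact ENNReal.zero_ne_top
  -- Zeroing the factors that violate `S ∩ X = Y` turns the sum over bundles into a product over
  -- goods; goods outside `X` contribute `p g + (1 - p g) = 1`.
  have hexp := Finset.prod_add (fun g => if g ∈ X \ Y then 0 else p g)
    (fun g => if g ∈ Y then 0 else 1 - p g) Finset.univ
  rw [Finset.powerset_univ] at hexp
  have hterm : ∀ S : Finset (Fin k),
      (∏ g ∈ S, if g ∈ X \ Y then 0 else p g) * (∏ g ∈ Finset.univ \ S,
        if g ∈ Y then 0 else 1 - p g) =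
      if S ∩ X = Y then (∏ g ∈ S, p g) * ∏ g ∈ Sᶜ, (1 - p g) else 0 := by
    intro S
    rw [← Finset.compl_eq_univ_sdiff]
    split_ifs with h
    · congr 1
      · refine Finset.prod_congr rfl fun g hg => if_neg fun hgX => ?_
        rw [Finset.mem_sdiff, ← h, Finset.mem_inter] at hgX
        exact hgX.2 ⟨hg, hgX.1⟩
      · refine Finset.prod_congr rfl fun g hg => if_neg fun hgY => ?_
        rw [← h, Finset.mem_inter] at hgY
        exact Finset.mem_compl.mp hg hgY.1
    · have : (∃ g ∈ S, g ∈ X \ Y) ∨ ∃ g ∈ Sᶜ, g ∈ Y := by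
        by_contra hcon
        push Not at hcon
        refine h (Finset.ext fun g => ?_)
        have h1 := hcon.1 g
        have h2 := hcon.2 g
        have h3 := @hYX g
        simp only [Finset.mem_sdiff, Finset.mem_compl, Finset.mem_inter] at *
        tauto
      rcases this with ⟨g, hg, hg'⟩ | ⟨g, hg, hg'⟩
      · rw [Finset.prod_eq_zero (f := fun g => if g ∈ X \ Y then (0 : ℝ) else p g) hg (if_pos hg'),
          zero_mul]
      · rw [Finset.prod_eq_zero (f := fun g => if g ∈ Y then (0 : ℝ) else 1 - p g) hg (if_pos hg'),
          mul_zero]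
  rw [hreal, ← Finset.sum_congr rfl fun S _ => hterm S, ← hexp]
  rw [← Finset.prod_sdiff (Finset.subset_univ X), ← Finset.prod_sdiff hYX]
  rw [Finset.prod_eq_one, one_mul, mul_comm]
  · congr 1
    · refine Finset.prod_congr rfl fun g hg => ?_
      simp [hg]
    · refine Finset.prod_congr rfl fun g hg => ?_
      rw [if_pos hg, if_neg (Finset.mem_sdiff.mp hg).2, zero_add]
  · intro g hg
    have hgX := (Finset.mem_sdiff.mp hg).2
    rw [if_neg fun h => hgX (Finset.mem_sdiff.mp h).1, if_neg fun h => hgX (hYX h)]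
    ring

theorem inclusionProb_eq (hp : ∀ g, 0 ≤ p g ∧ p g ≤ 1)
    (hD : ∀ S, D S = ENNReal.ofReal ((∏ g ∈ S, p g) * ∏ g ∈ Sᶜ, (1 - p g))) (g : Fin k) :
    inclusionProb D g = p g := by
  have h := measureReal_inter_eq hp hD (subset_refl ({g} : Finset (Fin k)))
  have hset : {S : Finset (Fin k) | g ∈ S} = {S | S ∩ {g} = {g}} := by
    ext S; simp [Finset.inter_eq_right]
  rw [inclusionProb, hset, h]
  simp

open scoped Classical in
-- Avoiding all better goods is independent of what happens at `g` and `h`; for `h ≠ g` the cases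
-- `{g}` and `{h}` are disjoint and their probabilities add.
theorem le_measureReal_separating {u : Finset (Fin k) → ℝ} (hp : ∀ g, 0 ≤ p g ∧ p g ≤ 1)
    (hD : ∀ S, D S = ENNReal.ofReal ((∏ g ∈ S, p g) * ∏ g ∈ Sᶜ, (1 - p g))) {q : ℝ}
    (hq : ∀ g, q ≤ p g) (hq' : ∀ g h, q ≤ p g * (1 - p h) + p h * (1 - p g))
    {g h : Fin k} (hh : u {h} ≤ u {g}) :
    (∏ x with u {g} < u {x}, (1 - p x)) * q ≤ D.toMeasure.real (separating u g h) := by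
  set W : Finset (Fin k) := {x | u {g} < u {x}} with hW
  have hWmem : ∀ x, x ∈ W ↔ u {g} < u {x} := fun x => by simp [hW]
  have hgW : g ∉ W := by simp [hW]
  have hhW : h ∉ W := by simp [hW, hh]
  have hWnn : 0 ≤ ∏ x ∈ W, (1 - p x) := Finset.prod_nonneg fun x _ => sub_nonneg.mpr (hp x).2
  have hle : ∀ T : Finset (Fin k), (∀ x ∈ T, x ∉ W) → ∀ x ∈ T, u {x} ≤ u {g} :=
    fun T hT x hx => not_lt.mp fun hlt => hT x hx ((hWmem x).mpr hlt)
  by_cases hgh : h = g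
  · have hc := measureReal_inter_eq hp hD (X := insert g W) (Y := {g}) (by simp)
    rw [show insert g W \ {g} = W by
      ext x; simp only [Finset.mem_sdiff, Finset.mem_insert, Finset.mem_singleton]; grind,
      Finset.prod_singleton] at hc
    calc (∏ x ∈ W, (1 - p x)) * q ≤ p g * ∏ x ∈ W, (1 - p x) := by
          rw [mul_comm]; exact mul_le_mul_of_nonneg_right (hq g) hWnn
      _ = _ := hc.symm
      _ ≤ _ := by
          refine measureReal_mono fun T hT => ?_
          have hT' : ∀ x, x ∈ T ∩ insert g W ↔ x ∈ ({g} : Finset (Fin k)) := fun x => by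
            rw [show T ∩ insert g W = {g} from hT]
          simp only [Finset.mem_inter, Finset.mem_insert, Finset.mem_singleton] at hT'
          exact ⟨hle T fun x hx hxW => by grind, Or.inl ⟨hgh, by grind⟩⟩
  · have h1 := measureReal_inter_eq hp hD (X := insert g (insert h W)) (Y := {g}) (by simp)
    have h2 := measureReal_inter_eq hp hD (X := insert g (insert h W)) (Y := {h}) (by simp)
    rw [show insert g (insert h W) \ {g} = insert h W by
      ext x; simp only [Finset.mem_sdiff, Finset.mem_insert, Finset.mem_singleton]; grind,
      Finset.prod_singleton, Finset.prod_insert hhW] at h1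
    rw [show insert g (insert h W) \ {h} = insert g W by
      ext x; simp only [Finset.mem_sdiff, Finset.mem_insert, Finset.mem_singleton]; grind,
      Finset.prod_singleton, Finset.prod_insert hgW] at h2
    have hdisj : Disjoint {S : Finset (Fin k) | S ∩ insert g (insert h W) = {g}}
        {S | S ∩ insert g (insert h W) = {h}} := by
      rw [Set.disjoint_left]
      intro S hS hS'
      have h3 : ({g} : Finset (Fin k)) = {h} := Eq.trans (Eq.symm hS) hS'
      exact hgh (Finset.singleton_injective h3).symm
    calc (∏ x ∈ W, (1 - p x)) * q
        ≤ (∏ x ∈ W, (1 - p x)) * (p g * (1 - p h) + p h * (1 - p g)) :=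
          mul_le_mul_of_nonneg_left (hq' g h) hWnn
      _ = p g * ((1 - p h) * ∏ x ∈ W, (1 - p x)) + p h * ((1 - p g) * ∏ x ∈ W, (1 - p x)) := by
          ring
      _ = _ := by rw [← h1, ← h2, ← measureReal_union hdisj (Set.toFinite _).measurableSet]
      _ ≤ _ := by
          refine measureReal_mono fun T hT => ?_
          rcases hT with hT | hT
          · have hT' : ∀ x, x ∈ T ∩ insert g (insert h W) ↔ x ∈ ({g} : Finset (Fin k)) :=
              fun x => by rw [show T ∩ insert g (insert h W) = {g} from hT]
            simp only [Finset.mem_inter, Finset.mem_insert, Finset.mem_singleton] at hT'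
            exact ⟨hle T fun x hx hxW => by grind, Or.inr ⟨hgh, by grind⟩⟩
          · have hT' : ∀ x, x ∈ T ∩ insert g (insert h W) ↔ x ∈ ({h} : Finset (Fin k)) :=
              fun x => by rw [show T ∩ insert g (insert h W) = {h} from hT]
            simp only [Finset.mem_inter, Finset.mem_insert, Finset.mem_singleton] at hT'
            exact ⟨hle T fun x hx hxW => by grind, Or.inr ⟨hgh, by grind⟩⟩

theorem measureReal_singleton_empty (hp : ∀ g, 0 ≤ p g ∧ p g ≤ 1)
    (hD : ∀ S, D S = ENNReal.ofReal ((∏ g ∈ S, p g) * ∏ g ∈ Sᶜ, (1 - p g))) :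
    D.toMeasure.real {∅} = ∏ g, (1 - p g) := by
  have h := measureReal_inter_eq hp hD (Finset.empty_subset Finset.univ)
  simpa using h

/-- The probability that `m` samples all miss a set of probability at least `q`. -/
theorem sampleMeasure_forall_notMem_le (D : PMF (Finset (Fin k))) (m : ℕ)
    {Q : Set (Finset (Fin k))} {q : ℝ} (hq : q ≤ D.toMeasure.real Q) :
    (sampleMeasure D m).real {ω | ∀ j, ω j ∉ Q} ≤ Real.exp (-(m * q)) := by
  have hset : {ω : Fin m → Finset (Fin k) | ∀ j, ω j ∉ Q} = Set.univ.pi fun _ => Qᶜ := by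
    ext ω; simp
  rw [hset, Measure.real, sampleMeasure, Measure.pi_pi, ENNReal.toReal_prod]
  simp only [Finset.prod_const, Finset.card_univ, Fintype.card_fin]
  have h1 : (D.toMeasure Qᶜ).toReal ≤ Real.exp (-q) := by
    have := probReal_compl_eq_one_sub (μ := D.toMeasure) (Set.toFinite Q).measurableSet
    rw [← Measure.real, this]
    have := Real.add_one_le_exp (-q)
    linarith
  calc _ ≤ Real.exp (-q) ^ m := pow_le_pow_left₀ ENNReal.toReal_nonneg h1 m
    _ = _ := by rw [← Real.exp_nat_mul]; congr 1; ring

instance instIsProbabilityMeasureSampleMeasure (D : PMF (Finset (Fin k))) (m : ℕ) :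
    IsProbabilityMeasure (sampleMeasure D m) := by
  unfold sampleMeasure; infer_instance

end Product

/-! ### Numerical estimates -/

section Numerics

theorem exp_neg_one_div_le {k : ℕ} (hk : 3 < k) :
    Real.exp (-1 / (k : ℝ)) ≤ 1 - 1 / ((k : ℝ) + 1) := by
  have hk0 : (0 : ℝ) < k := by positivity
  have h := Real.add_one_le_exp (1 / (k : ℝ))
  rw [show -1 / (k : ℝ) = -(1 / k) by ring, Real.exp_neg]
  calc (Real.exp (1 / (k : ℝ)))⁻¹ ≤ (1 / (k : ℝ) + 1)⁻¹ := inv_anti₀ (by positivity) h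
    _ = _ := by field_simp; ring

theorem sq_sqrt_two_mul_exp_sub_one {k : ℕ} (hk : 3 < k) :
    Real.sqrt (2 * Real.exp (-1 / (k : ℝ)) - 1) ^ 2 = 2 * Real.exp (-1 / (k : ℝ)) - 1 := by
  refine Real.sq_sqrt ?_
  have h := Real.add_one_le_exp (-1 / (k : ℝ))
  have hk' : (4 : ℝ) ≤ k := by exact_mod_cast hk
  have : 1 / (k : ℝ) ≤ 1 / 4 := one_div_le_one_div_of_le (by norm_num) hk'
  rw [show -1 / (k : ℝ) = -(1 / k) by ring] at *
  linarith

/-- With `t = exp (-1 / k)`, `2t - 1 ≤ t²`, so the root is at most `t`. -/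
theorem sqrt_two_mul_exp_sub_one_le {k : ℕ} (hk : 3 < k) :
    Real.sqrt (2 * Real.exp (-1 / (k : ℝ)) - 1) ≤ 1 - 1 / ((k : ℝ) + 1) := by
  refine le_trans ?_ (exp_neg_one_div_le hk)
  refine abs_le_of_sq_le_sq' ?_ (Real.exp_pos _).le |>.2
  rw [sq_sqrt_two_mul_exp_sub_one hk]
  nlinarith [sq_nonneg (Real.exp (-1 / (k : ℝ)) - 1)]

/-- Lower bound for the probability that exactly one of two independent events occurs. -/
theorem one_sub_le_exactly_one {s t x y : ℝ} (hs : s ^ 2 = 2 * t - 1) (hs1 : s ≤ 1)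
    (hx : 1 - s ≤ x) (hx' : x ≤ 1 / 2 + s / 2) (hy : 1 - s ≤ y) (hy' : y ≤ 1 / 2 + s / 2) :
    1 - t ≤ x * (1 - y) + y * (1 - x) := by
  -- The target follows from `2(x(1 - y) + y(1 - x)) = 1 - (1 - 2x)(1 - 2y) ≥ 1 - s² = 2(1 - t)`.
  have h1 : |1 - 2 * x| ≤ s := abs_le.mpr ⟨by linarith, by linarith⟩
  have h2 : |1 - 2 * y| ≤ s := abs_le.mpr ⟨by linarith, by linarith⟩
  have h3 : |1 - 2 * x| * |1 - 2 * y| ≤ s * s :=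
    mul_le_mul h1 h2 (abs_nonneg _) ((abs_nonneg _).trans h1)
  rw [← abs_mul] at h3
  have h4 := (le_abs_self _).trans h3
  nlinarith

theorem sq_add_one_mul_exp_le {k : ℕ} (hk : 3 < k) :
    ((k : ℝ) ^ 2 + 1) * Real.exp (-(((k : ℝ) - 1) * k / 2)) ≤ Real.exp (-(k : ℝ) / 4) := by
  have hk' : (4 : ℝ) ≤ k := by exact_mod_cast hk
  have h1 : (k : ℝ) ^ 2 + 1 ≤ Real.exp k := by
    have h := Real.sum_le_exp_of_nonneg (x := k) (by positivity) 4
    simp only [Finset.sum_range_succ, Finset.sum_range_zero] at h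
    norm_num [Nat.factorial] at h
    nlinarith [mul_nonneg (sub_nonneg.mpr hk') (sq_nonneg (k : ℝ))]
  calc _ ≤ Real.exp k * Real.exp (-(((k : ℝ) - 1) * k / 2)) :=
        mul_le_mul_of_nonneg_right h1 (Real.exp_pos _).le
    _ = Real.exp (k + -(((k : ℝ) - 1) * k / 2)) := (Real.exp_add _ _).symm
    _ ≤ _ := Real.exp_le_exp.mpr (by nlinarith)

/-- The product of `r` factors `1 - p` with `p ≤ β`, when `(1 - β) ^ r > exp (-L)`. -/
theorem exp_neg_le_prod {ι : Type*} {W : Finset ι} {p : ι → ℝ} {β L : ℝ} (hβ0 : 0 < β)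
    (hβ1 : β < 1) (hp : ∀ x, p x ≤ β) (hW : (W.card : ℝ) < L / Real.log (1 / (1 - β))) :
    Real.exp (-L) ≤ ∏ x ∈ W, (1 - p x) := by
  have hpos : 0 < 1 - β := by linarith
  have hlog : 0 < Real.log (1 / (1 - β)) :=
    Real.log_pos (by rw [lt_div_iff₀ hpos]; linarith)
  rw [lt_div_iff₀ hlog, one_div, Real.log_inv] at hW
  calc Real.exp (-L) ≤ Real.exp (W.card * Real.log (1 - β)) :=
        Real.exp_le_exp.mpr (by linarith)
    _ = (1 - β) ^ W.card := by rw [Real.exp_nat_mul, Real.exp_log hpos]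
    _ = ∏ _x ∈ W, (1 - β) := by rw [Finset.prod_const]
    _ ≤ _ := Finset.prod_le_prod (fun _ _ => hpos.le) fun x _ => by linarith [hp x]

/-- With `x = max n k`, the exponential is `1 / x` and `m ≥ k²x²`, so the right side is at least
`k²x / (2(k + 1)) ≥ k³ / (2(k + 1))`. -/
theorem le_mul_exp_neg {n k m : ℕ} (hn : 1 ≤ n) (hk : 3 < k)
    (hm : max (k ^ 2 * n ^ 2) (k ^ 4) ≤ m) :
    ((k : ℝ) - 1) * k / 2 ≤
      m * (Real.exp (-max (Real.log n) (Real.log k)) * (1 / ((k : ℝ) + 1) / 2)) := by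
  have hk' : (4 : ℝ) ≤ k := by exact_mod_cast hk
  have key : ∀ x : ℝ, (k : ℝ) ≤ x → (k : ℝ) ^ 2 * x ^ 2 ≤ m →
      ((k : ℝ) - 1) * k / 2 ≤ m * (x⁻¹ * (1 / ((k : ℝ) + 1) / 2)) := by
    intro x hx hmx
    have hx0 : 0 < x := by linarith
    calc ((k : ℝ) - 1) * k / 2 ≤ (k : ℝ) ^ 2 * x / (((k : ℝ) + 1) * 2) := by
          rw [div_le_div_iff₀ (by norm_num) (by positivity)]
          nlinarith [mul_le_mul_of_nonneg_left hx (sq_nonneg (k : ℝ))]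
      _ = (k : ℝ) ^ 2 * x ^ 2 * (x⁻¹ * (1 / ((k : ℝ) + 1) / 2)) := by field_simp
      _ ≤ _ := mul_le_mul_of_nonneg_right hmx (by positivity)
  have hn0 : (0 : ℝ) < n := by exact_mod_cast hn
  have hk0 : (0 : ℝ) < k := by linarith
  rw [Real.exp_neg]
  rcases le_total (Real.log n) (Real.log k) with h | h
  · rw [max_eq_right h, Real.exp_log hk0]
    refine key k le_rfl ?_
    have : k ^ 2 * k ^ 2 ≤ m := by
      have := (le_max_right _ _).trans hm
      calc k ^ 2 * k ^ 2 = k ^ 4 := by ring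
        _ ≤ m := this
    exact_mod_cast this
  · rw [max_eq_left h, Real.exp_log hn0]
    refine key n ((Real.log_le_log_iff hk0 hn0).mp h) ?_
    exact_mod_cast (le_max_left _ _).trans hm

/-- Here `1 - β ≥ 1 / (2(k + 1))`, and `2(k + 1) ≤ k²` for `k ≥ 4`. This yields `ρ ≥ 1 / 2`. -/
theorem log_one_div_one_sub_le {k : ℕ} (hk : 3 < k) {β : ℝ}
    (hβ : β ≤ 1 / 2 + Real.sqrt (2 * Real.exp (-1 / (k : ℝ)) - 1) / 2) :
    Real.log (1 / (1 - β)) ≤ 2 * Real.log k := by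
  have hs := sqrt_two_mul_exp_sub_one_le hk
  have hk' : (4 : ℝ) ≤ k := by exact_mod_cast hk
  have h1 : 1 / ((k : ℝ) + 1) / 2 ≤ 1 - β := by linarith
  have h2 : 0 < 1 / ((k : ℝ) + 1) / 2 := by positivity
  have h3 : 1 / (1 - β) ≤ (k : ℝ) ^ 2 := by
    calc 1 / (1 - β) ≤ 1 / (1 / ((k : ℝ) + 1) / 2) := one_div_le_one_div_of_le h2 h1
      _ = 2 * ((k : ℝ) + 1) := by field_simp
      _ ≤ _ := by nlinarith
  calc _ ≤ Real.log ((k : ℝ) ^ 2) := Real.log_le_log (one_div_pos.mpr (h2.trans_le h1)) h3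
    _ = _ := by rw [Real.log_pow]; norm_num

end Numerics

/-! ### Union bound over the failure events -/

section Success

open MeasureTheory

variable {n k m : ℕ} {v : Fin n → Finset (Fin k) → ℝ}

/-- Failure to observe a separating sample that is needed for one of the rounds. -/
def unseparated (v : Fin n → Finset (Fin k) → ℝ) (m : ℕ) (ρ : ℝ) (x : Fin n × Fin k × Fin k) :
    Set (Fin m → Finset (Fin k)) :=
  {ω | v x.1 {x.2.2} ≤ v x.1 {x.2.1} ∧
    (Set.ncard {g' : Fin k | v x.1 {x.2.1} < v x.1 {g'}} : ℝ) < ρ ∧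
    ∀ j, ω j ∉ separating (v x.1) x.2.1 x.2.2}

/-- Failure to observe the empty bundle, if it is needed. -/
def emptyUnobserved (k m : ℕ) (ρ : ℝ) : Set (Fin m → Finset (Fin k)) :=
  {ω | (k : ℝ) - 1 < ρ ∧ ∀ j, ω j ∉ ({∅} : Set (Finset (Fin k)))}

theorem whileLoop_eq_serialBundle (hv : ∀ i, IsUnitDemand (v i))
    (hdistinct : ∀ i, Function.Injective fun g : Fin k => v i {g}) {ρ : ℝ}
    (hrank : ∀ (i : Fin n) (g : Fin k), IsGreedyGood v i g →
      (Set.ncard {g' : Fin k | v i {g} < v i {g'}} : ℝ) < ρ) {ω : Fin m → Finset (Fin k)}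
    (hω : ω ∉ (⋃ x, unseparated v m ρ x) ∪ emptyUnobserved k m ρ) (i : Fin n) :
    whileLoop (v i) (Finset.univ.image ω) (takenBefore v i) (Finset.univ.image ω) =
      serialBundle v i := by
  simp only [Set.mem_union, Set.mem_iUnion, not_or, not_exists] at hω
  refine whileLoop_eq_demand (hv i) (hdistinct i) (fun g hg h hh => ?_) fun he => ?_
  · by_contra hcon
    push Not at hcon
    exact hω.1 (i, g, h) ⟨hh, ncard_better_serialBundle_lt hv hdistinct hrank hg,
      fun j => hcon _ (Finset.mem_image_of_mem ω (Finset.mem_univ j))⟩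
  · refine (eq_univ_or_lt_of_serialBundle_eq_empty hv hdistinct hrank he).imp_right fun hlt => ?_
    by_contra hcon
    refine hω.2 ⟨hlt, fun j hj => hcon ?_⟩
    exact Finset.mem_image.mpr ⟨j, Finset.mem_univ j, hj⟩

theorem measureReal_unseparated_union_le (hn : 1 ≤ n) (hk : 3 < k)
    {D : PMF (Finset (Fin k))} (hD : IsProductDistribution D) {α β : ℝ}
    (hprob : ∀ g, inclusionProb D g ∈ Set.Icc α β)
    (hα : 1 - Real.sqrt (2 * Real.exp (-1 / (k : ℝ)) - 1) ≤ α)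
    (hβ : β ≤ 1 / 2 + Real.sqrt (2 * Real.exp (-1 / (k : ℝ)) - 1) / 2)
    (hm : max (k ^ 2 * n ^ 2) (k ^ 4) ≤ m) :
    (sampleMeasure D m).real
      ((⋃ x, unseparated v m (max (Real.log n) (Real.log k) / Real.log (1 / (1 - β))) x) ∪
        emptyUnobserved k m (max (Real.log n) (Real.log k) / Real.log (1 / (1 - β)))) ≤
      n * Real.exp (-(k : ℝ) / 4) := by
  obtain ⟨p, hp, hDp⟩ := hD
  simp only [inclusionProb_eq hp hDp] at hprob
  set L := max (Real.log n) (Real.log k) with hL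
  set ρ := L / Real.log (1 / (1 - β)) with hρ
  set s := Real.sqrt (2 * Real.exp (-1 / (k : ℝ)) - 1) with hs
  set a : ℝ := 1 / ((k : ℝ) + 1) with ha
  have hk' : (4 : ℝ) ≤ k := by exact_mod_cast hk
  have ha0 : 0 < a := by positivity
  have hsa : s ≤ 1 - a := sqrt_two_mul_exp_sub_one_le hk
  have hαβ : α ≤ β := (hprob ⟨0, by omega⟩).1.trans (hprob ⟨0, by omega⟩).2
  have hβ0 : 0 < β := by linarith
  have hβ1 : β < 1 := by linarith
  have hpβ : ∀ x, p x ≤ β := fun x => (hprob x).2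
  have hmL := le_mul_exp_neg hn hk hm
  have bound : ∀ Q : Set (Finset (Fin k)), Real.exp (-L) * (a / 2) ≤ D.toMeasure.real Q →
      (sampleMeasure D m).real {ω | ∀ j, ω j ∉ Q} ≤ Real.exp (-(((k : ℝ) - 1) * k / 2)) :=
    fun Q hQ => (sampleMeasure_forall_notMem_le D m hQ).trans
      (Real.exp_le_exp.mpr (neg_le_neg hmL))
  have hsep : ∀ x, (sampleMeasure D m).real (unseparated v m ρ x) ≤
      Real.exp (-(((k : ℝ) - 1) * k / 2)) := by
    classical
    rintro ⟨i, g, h⟩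
    by_cases hc : v i {h} ≤ v i {g} ∧ (Set.ncard {g' : Fin k | v i {g} < v i {g'}} : ℝ) < ρ
    · refine le_trans (measureReal_mono fun ω hω => hω.2.2) (bound _ ?_)
      refine le_trans ?_ (le_measureReal_separating hp hDp (q := a)
        (fun g => by linarith [(hprob g).1]) (fun g h => ?_) hc.1)
      · refine mul_le_mul (exp_neg_le_prod hβ0 hβ1 hpβ ?_) (by linarith) (by positivity)
          (Finset.prod_nonneg fun x _ => sub_nonneg.mpr (hp x).2)
        rw [← Set.ncard_coe_finset]
        simpa only [Finset.coe_filter, Finset.mem_univ, true_and] using hc.2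
      · refine le_trans ?_ (one_sub_le_exactly_one (sq_sqrt_two_mul_exp_sub_one hk)
          (by linarith) (hα.trans (hprob g).1) ((hprob g).2.trans hβ) (hα.trans (hprob h).1)
          ((hprob h).2.trans hβ))
        linarith [exp_neg_one_div_le hk]
    · rw [show unseparated v m ρ (i, g, h) = ∅ from
        Set.eq_empty_of_forall_notMem fun ω hω => hc ⟨hω.1, hω.2.1⟩]
      simpa using (Real.exp_pos _).le
  have hemp : (sampleMeasure D m).real (emptyUnobserved k m ρ) ≤
      Real.exp (-(((k : ℝ) - 1) * k / 2)) := by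
    by_cases hc : (k : ℝ) - 1 < ρ
    · refine le_trans (measureReal_mono fun ω hω => hω.2) (bound _ ?_)
      rw [measureReal_singleton_empty hp hDp]
      have g : Fin k := ⟨0, by omega⟩
      -- Since `k - 1 < ρ`, the estimate covers only `k - 1` factors. The remaining one is at least
      -- `1 - β ≥ a / 2`, which is why `bound` uses `a / 2` and not `a`.
      rw [← Finset.prod_erase_mul _ _ (Finset.mem_univ g)]
      refine mul_le_mul (exp_neg_le_prod hβ0 hβ1 hpβ ?_) (by linarith [hpβ g]) (by positivity)
          (Finset.prod_nonneg fun x _ => sub_nonneg.mpr (hp x).2)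
      rw [Finset.card_erase_of_mem (Finset.mem_univ g), Finset.card_univ, Fintype.card_fin,
        Nat.cast_sub (by omega), Nat.cast_one]
      exact hc
    · rw [show emptyUnobserved k m ρ = ∅ from
        Set.eq_empty_of_forall_notMem fun ω hω => hc hω.1]
      simpa using (Real.exp_pos _).le
  have hn' : (1 : ℝ) ≤ n := by exact_mod_cast hn
  set ε := Real.exp (-(((k : ℝ) - 1) * k / 2)) with hε
  have hε0 : 0 < ε := Real.exp_pos _
  calc _ ≤ (sampleMeasure D m).real (⋃ x, unseparated v m ρ x) +
        (sampleMeasure D m).real (emptyUnobserved k m ρ) := measureReal_union_le _ _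
    _ ≤ (∑ _x : Fin n × Fin k × Fin k, ε) + ε :=
        add_le_add ((measureReal_iUnion_fintype_le _).trans
          (Finset.sum_le_sum fun x _ => hsep x)) hemp
    _ = (n * (k : ℝ) ^ 2 + 1) * ε := by
        simp only [Finset.sum_const, Finset.card_univ, Fintype.card_prod, Fintype.card_fin,
          nsmul_eq_mul]
        push_cast
        ring
    _ ≤ n * (((k : ℝ) ^ 2 + 1) * ε) := by nlinarith
    _ ≤ _ := mul_le_mul_of_nonneg_left (sq_add_one_mul_exp_le hk) (by linarith)

end Success

end FisherMarket

end

theorem mainTheorem1 (n k m : ℕ) (hn : 1 ≤ n) (hk : 3 < k)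
    (v : Fin n → Finset (Fin k) → ℝ) (hv : ∀ i, FisherMarket.IsUnitDemand (v i))
    (hdistinct : ∀ i, Function.Injective fun g : Fin k => v i {g})
    (b : Fin n → ℝ) (hbpos : ∀ i, 0 < b i) (hb : StrictAnti b)
    (D : PMF (Finset (Fin k))) (hD : FisherMarket.IsProductDistribution D)
    (α β : ℝ)
    (hprob : ∀ g, FisherMarket.inclusionProb D g ∈ Set.Icc α β)
    (hα : 1 - Real.sqrt (2 * Real.exp (-1 / (k : ℝ)) - 1) ≤ α)
    (hβ : β ≤ 1 / 2 + Real.sqrt (2 * Real.exp (-1 / (k : ℝ)) - 1) / 2)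
    (hrank : ∀ (i : Fin n) (g : Fin k), FisherMarket.IsGreedyGood v i g →
      (Set.ncard {g' : Fin k | v i {g} < v i {g'}} : ℝ) <
        max (Real.log n) (Real.log k) / Real.log (1 / (1 - β)))
    (hm : max (k ^ 2 * n ^ 2) (k ^ 4) ≤ m) :
    (∃ O, FisherMarket.IsOptimalEquilibrium v b O) ∧
    ∀ O, FisherMarket.IsOptimalEquilibrium v b O →
      1 - 2 * n * max (Real.log n) (Real.log k) / Real.log (1 / (1 - β)) *
          Real.exp (-(k : ℝ) / 4) ≤
        (FisherMarket.sampleMeasure D m).real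
          {ω | FisherMarket.efficiencyRatio v
            (FisherMarket.directAlgorithm v b (Finset.univ.image ω)).alloc O.alloc = 1} := by
  refine ⟨⟨_, FisherMarket.isOptimalEquilibrium_serialOutcome hv hdistinct hbpos hb⟩,
    fun O hO => ?_⟩
  have hbad := FisherMarket.measureReal_unseparated_union_le (v := v) hn hk hD hprob hα hβ hm
  set ρ := max (Real.log n) (Real.log k) / Real.log (1 / (1 - β)) with hρ
  set bad := (⋃ x, FisherMarket.unseparated v m ρ x) ∪ FisherMarket.emptyUnobserved k m ρ
  have hcompl := MeasureTheory.probReal_compl_eq_one_sub (μ := FisherMarket.sampleMeasure D m)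
    (Set.toFinite bad).measurableSet
  have hmono : (FisherMarket.sampleMeasure D m).real badᶜ ≤
      (FisherMarket.sampleMeasure D m).real
        {ω | FisherMarket.efficiencyRatio v
          (FisherMarket.directAlgorithm v b (Finset.univ.image ω)).alloc O.alloc = 1} := by
    refine MeasureTheory.measureReal_mono fun ω hω => ?_
    have hpos := FisherMarket.welfare_serialBundle_pos hn (by omega) hv hdistinct
    change FisherMarket.welfare v _ / FisherMarket.welfare v _ = 1
    rw [FisherMarket.welfare_directAlgorithm_eq hv b
      (FisherMarket.whileLoop_eq_serialBundle hv hdistinct hrank hω),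
      hO.welfare_eq hv hdistinct hbpos hb, div_self hpos.ne']
  -- This absorbs the factor `n` of the union bound into `2 n ρ`.
  have hρ2 : 1 / 2 ≤ ρ := by
    have hs := FisherMarket.sqrt_two_mul_exp_sub_one_le hk
    have ha0 : 0 < 1 / ((k : ℝ) + 1) := by positivity
    have hαβ : α ≤ β := (hprob ⟨0, by omega⟩).1.trans (hprob ⟨0, by omega⟩).2
    have hlog : 0 < Real.log (1 / (1 - β)) :=
      Real.log_pos (by rw [lt_div_iff₀ (by linarith)]; linarith)
    rw [hρ, le_div_iff₀ hlog]
    have h1 := FisherMarket.log_one_div_one_sub_le hk hβ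
    have h2 := le_max_right (Real.log n) (Real.log k)
    linarith
  have hfin : n * Real.exp (-(k : ℝ) / 4) ≤ 2 * n * max (Real.log n) (Real.log k) /
      Real.log (1 / (1 - β)) * Real.exp (-(k : ℝ) / 4) := by
    refine mul_le_mul_of_nonneg_right ?_ (Real.exp_pos _).le
    rw [mul_div_assoc, ← hρ]
    have : (0 : ℝ) ≤ n := Nat.cast_nonneg n
    nlinarith
  linarith
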